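/- For a metrizable space $Z$ and $z\in Z$, let $\pi_1(Z,z)$ denote the topological fundamental group: the set of path components of the space of loops $f:[0,1]\to Z$, $f(0)=f(1)=z$ (with the topology of uniform convergence), with the quotient topology. A metric space $X$ is similar to the Hawaiian earring, with distinguished point $p\in X$, if $X=\bigcup_{n=1}^\infty Y_n$, where $Y_n\cap Y_m=\{p\}$ whenever $n\neq m$, each $Y_n$ is closed in $X$, path connected, locally simply connected at $p$ (that is, $p$ has arbitrarily small simply connected neighbourhoods in $Y_n$) and not simply connected, and $\lim_{n\to\infty}\operatorname{diam}(Y_n)=0$. Theorem. Let $X$ be similar to the Hawaiian earring, with distinguished point $p$, let $Y$ be a metrizable space and let $y_0\in Y$ be such that $\pi_1(Y,y_0)$ is completely metrizable (that is, its topology is induced by a complete metric). Then $X$ cannot be embedded as a retract of $Y$ (within the path component of $y_0$): there is no topological embedding $e:X\to Y$ such that $e(p)$ lies in the path component of $y_0$ (for instance $e(p)=y_0$) and $e(X)$ is a retract of $Y$, i.e. such that some continuous map $r:Y\to e(X)$ restricts to the identity on $e(X)$. -/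

import Mathlib

open Topology

/-- The topological fundamental group of `X` at `p`, as a space: the set of path components of the
space `Path p p` of loops at `p`, with the quotient topology. Mathlib's topology on `Path p p` is
the compact-open topology, which for metrizable `X` is that of uniform convergence. -/
def TopFundamentalGroup (X : Type*) [TopologicalSpace X] (p : X) : Type _ :=
  ZerothHomotopy (Path p p)

instance TopFundamentalGroup.instTopologicalSpace (X : Type*) [TopologicalSpace X] (p : X) :
    TopologicalSpace (TopFundamentalGroup X p) :=
  inferInstanceAs (TopologicalSpace (Quotient (pathSetoid (Path p p))))

/-- The subspace `A` of `Y` is a retract of `Y`: some continuous map `Y → A` restricts to the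
identity of `A`. -/
def IsRetract {Y : Type*} [TopologicalSpace Y] (A : Set Y) : Prop :=
  ∃ r : C(Y, A), ∀ a : A, r a = a

/-- `Z` is locally simply connected at `z`: the point `z` has arbitrarily small simply connected
neighbourhoods (not required to be open). -/
def LocallySimplyConnectedAt {Z : Type*} [TopologicalSpace Z] (z : Z) : Prop :=
  ∀ U ∈ 𝓝 z, ∃ V ∈ 𝓝 z, V ⊆ U ∧ IsSimplyConnected V

/-- The metric space `X` is similar to the Hawaiian earring, with distinguished point `p`, the
pieces being the sets `Y n`. The diameter is the extended one, so that finitely many pieces may be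
unbounded. -/
structure IsHawaiianDecomposition {X : Type*} [MetricSpace X] (p : X) (Y : ℕ → Set X) : Prop where
  iUnion_eq : ⋃ n, Y n = Set.univ
  inter_eq : ∀ n m, n ≠ m → Y n ∩ Y m = {p}
  isClosed : ∀ n, IsClosed (Y n)
  isPathConnected : ∀ n, IsPathConnected (Y n)
  locallySimplyConnectedAt : ∀ n (hp : p ∈ Y n), LocallySimplyConnectedAt (⟨p, hp⟩ : Y n)
  not_isSimplyConnected : ∀ n, ¬ IsSimplyConnected (Y n)
  tendsto_diam : Filter.Tendsto (fun n => Metric.ediam (Y n)) Filter.atTop (𝓝 0)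

/-- `X` is similar to the Hawaiian earring, with distinguished point `p`. -/
def IsSimilarToHawaiianEarring (X : Type*) [MetricSpace X] (p : X) : Prop :=
  ∃ Y : ℕ → Set X, IsHawaiianDecomposition p Y

/-!
Suppose that `π₁(X, p)` were `T₁` and first countable. Choose essential loops `f n` in the pieces;
they converge to the constant loop, so for each `k` the classes of `⁅f 0, f n⁆ ^ k` converge to `1`
as `n → ∞`, and so does, for `k → ∞`, a diagonal sequence `c k = ⁅f 0, f (φ k)⁆ ^ k`, `k ≥ 1`. On
the other hand, collapsing `X` onto the pieces `0` and `n` yields a homomorphism from the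
fundamental group of `X` to the free product of those of the two pieces, under which
`⁅f 0, f n⁆ ^ k` has word length `4 * k`. A loop and all loops near it can be cut into the same
finite number of arcs, each contributing at most one letter whatever `n` is, so the word length is
locally bounded on the loop space, uniformly in `n`. Hence the preimages of the points `c k` in the
loop space are locally finite, and the set of the `c k` is closed in the quotient. It does not
contain `1`, which contradicts the convergence. Finally, a retraction makes `π₁(X, p)` a subspace
of `π₁(Y, y₀)`.

The homomorphism is obtained without van Kampen's theorem for `X`: the product of the transports in
the two pieces is a cocycle as long as one of them is trivial, hence locally, and a local cocycle on
a simply connected space integrates to a global one.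
-/

open Filter in
theorem exists_tendsto_diagonal {α β : Type*} {la : Filter α} [la.NeBot] {l : Filter β}
    [l.IsCountablyGenerated] {u : ℕ → α → β} (hu : ∀ k, Tendsto (u k) la l) :
    ∃ φ : ℕ → α, Tendsto (fun k => u k (φ k)) atTop l := by
  obtain ⟨s, hs⟩ := l.exists_antitone_basis
  have hex : ∀ k, ∃ a, u k a ∈ s k := fun k => ((hu k).eventually (hs.mem k)).exists
  choose φ hφ using hex
  refine ⟨φ, hs.tendsto_right_iff.2 fun i _ => ?_⟩
  filter_upwards [eventually_ge_atTop i] with k hk using hs.antitone hk (hφ k)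

theorem isClosed_range_of_locallyFinite_preimage {S T ι : Type*} [TopologicalSpace S]
    [TopologicalSpace T] [T1Space T] {q : S → T} (hq : IsQuotientMap q) {c : ι → T}
    (hc : LocallyFinite fun i => q ⁻¹' {c i}) : IsClosed (Set.range c) := by
  have hpre : q ⁻¹' Set.range c = ⋃ i, q ⁻¹' {c i} := by
    ext x; simp [eq_comm]
  rw [← hq.isClosed_preimage, hpre]
  exact hc.isClosed_iUnion fun i => isClosed_singleton.preimage hq.continuous

section ZerothHomotopy

variable {L M : Type*} [TopologicalSpace L] [TopologicalSpace M]

/-- The map induced by a continuous map on sets of path components. -/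
def zerothHomotopyMap (f : C(L, M)) : ZerothHomotopy L → ZerothHomotopy M :=
  ZerothHomotopy.lift (fun x => ZerothHomotopy.mk (f x)) fun _ _ h =>
    ZerothHomotopy.sound (h.map f.continuous)

theorem continuous_zerothHomotopyMap (f : C(L, M)) : Continuous (zerothHomotopyMap f) :=
  ZerothHomotopy.isQuotientMap_mk.continuous_iff.2
    (ZerothHomotopy.isQuotientMap_mk.continuous.comp f.continuous)

theorem isEmbedding_zerothHomotopyMap (f : C(L, M)) (g : C(M, L))
    (h : ∀ x, Joined (g (f x)) x) : IsEmbedding (zerothHomotopyMap f) := by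
  have hleft : Function.LeftInverse (zerothHomotopyMap g) (zerothHomotopyMap f) :=
    ZerothHomotopy.mk_surjective.forall.2 fun x => ZerothHomotopy.sound (h x).somePath
  exact hleft.isEmbedding (continuous_zerothHomotopyMap g) (continuous_zerothHomotopyMap f)

end ZerothHomotopy

section Cocycle

open Filter

variable {G Z Z' : Type*} [Group G]

/-- A nonabelian `1`-cocycle on `N`: `d u v` plays the role of the value transported from `u` to
`v`, and later factors are written on the left. -/
def IsCocycleOn (d : Z → Z → G) (N : Set Z) : Prop :=
  ∀ ⦃u⦄, u ∈ N → ∀ ⦃v⦄, v ∈ N → ∀ ⦃w⦄, w ∈ N → d v w * d u v = d u w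

theorem IsCocycleOn.self {d : Z → Z → G} {N : Set Z} (hd : IsCocycleOn d N) {u : Z}
    (hu : u ∈ N) : d u u = 1 :=
  mul_eq_left.1 (hd hu hu hu)

variable [TopologicalSpace Z] [TopologicalSpace Z']

/-- A function of two points that is a cocycle near every point: a `1`-form with values in a
nonabelian group. -/
def IsLocalCocycle (d : Z → Z → G) : Prop :=
  ∀ z, ∃ N ∈ 𝓝 z, IsCocycleOn d N

/-- `θ` is a primitive of the local cocycle `d`: near every point, its increments are given
by `d`. -/
def IsPrimitive (d : Z → Z → G) (θ : Z → G) : Prop :=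
  ∀ z, ∃ N ∈ 𝓝 z, ∀ u ∈ N, ∀ v ∈ N, θ v = d u v * θ u

variable {d : Z → Z → G}

theorem IsLocalCocycle.comp (hd : IsLocalCocycle d) {h : Z' → Z} (hh : Continuous h) :
    IsLocalCocycle fun u v => d (h u) (h v) := fun z =>
  let ⟨N, hN, hdN⟩ := hd (h z)
  ⟨h ⁻¹' N, hh.continuousAt hN, fun _ hu _ hv _ hw => hdN hu hv hw⟩

theorem IsPrimitive.comp {θ : Z → G} (hθ : IsPrimitive d θ) {h : Z' → Z} (hh : Continuous h) :
    IsPrimitive (fun u v => d (h u) (h v)) (θ ∘ h) := fun z =>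
  let ⟨N, hN, hθN⟩ := hθ (h z)
  ⟨h ⁻¹' N, hh.continuousAt hN, fun u hu v hv => hθN (h u) hu (h v) hv⟩

theorem IsPrimitive.mul_inv_eq [PreconnectedSpace Z] {θ θ' : Z → G} (hθ : IsPrimitive d θ)
    (hθ' : IsPrimitive d θ') (u v : Z) : θ v * (θ u)⁻¹ = θ' v * (θ' u)⁻¹ := by
  have hconst : IsLocallyConstant fun z => (θ' z)⁻¹ * θ z := by
    refine (IsLocallyConstant.iff_eventually_eq _).2 fun z => ?_
    obtain ⟨N, hN, hθN⟩ := hθ z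
    obtain ⟨N', hN', hθN'⟩ := hθ' z
    filter_upwards [hN, hN'] with w hw hw'
    rw [hθN z (mem_of_mem_nhds hN) w hw, hθN' z (mem_of_mem_nhds hN') w hw']
    group
  have huv := hconst.apply_eq_of_preconnectedSpace u v
  rw [inv_mul_eq_iff_eq_mul] at huv
  rw [huv]
  group

/-- The covering space of `Z` whose sections are the primitives of the local cocycle `d`; here `N z`
is a neighbourhood of `z` on which `d` is a cocycle. -/
def IsLocalCocycle.fiberBundleCore [TopologicalSpace G] (N : Z → Set Z)
    (hN : ∀ z, N z ∈ 𝓝 z) (hd : ∀ z, IsCocycleOn d (N z)) [DiscreteTopology G] :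
    FiberBundleCore Z Z G where
  baseSet z := interior (N z)
  isOpen_baseSet _ := isOpen_interior
  indexAt := id
  mem_baseSet_at z := mem_interior_iff_mem_nhds.2 (hN z)
  coordChange i j x g := d x j * (d x i)⁻¹ * g
  coordChange_self i x _ g := by simp
  continuousOn_coordChange i j := by
    rintro ⟨x, g⟩ ⟨⟨hxi, hxj⟩, -⟩
    have hcont : Continuous fun p : Z × G => d x j * (d x i)⁻¹ * p.2 :=
      continuous_of_discreteTopology.comp continuous_snd
    refine hcont.continuousWithinAt.congr_of_mem (fun ⟨y, g'⟩ ⟨⟨hyi, hyj⟩, _⟩ => ?_)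
      ⟨⟨hxi, hxj⟩, Set.mem_univ g⟩
    have hi := hd i (interior_subset hyi) (interior_subset hxi) (mem_of_mem_nhds (hN i))
    have hj := hd j (interior_subset hyj) (interior_subset hxj) (mem_of_mem_nhds (hN j))
    simp only [← hi, ← hj]
    group
  coordChange_comp i j k x _ g := by group

theorem IsLocalCocycle.exists_isPrimitive [SimplyConnectedSpace Z] [LocallyPathConnectedSpace Z]
    (hd : IsLocalCocycle d) : ∃ θ : Z → G, IsPrimitive d θ := by
  let _ : TopologicalSpace G := ⊥
  have _ : DiscreteTopology G := ⟨rfl⟩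
  choose N hN hdN using hd
  let B := IsLocalCocycle.fiberBundleCore N hN hdN
  have hB : IsCoveringMap (Bundle.TotalSpace.proj : Bundle.TotalSpace G B.Fiber → Z) :=
    FiberBundle.isCoveringMap
  let z₀ : Z := Classical.arbitrary Z
  obtain ⟨s, ⟨-, hs⟩, -⟩ := hB.existsUnique_continuousMap_lifts (.id Z) z₀ ⟨z₀, (1 : G)⟩ rfl
  have hsx : ∀ x, (s x).1 = x := congrFun hs
  let θ : Z → G := fun x => (s x).2
  refine ⟨θ, fun z => ?_⟩
  have hz : z ∈ N z := mem_of_mem_nhds (hN z)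
  have hcont : ContinuousAt (fun x => ((B.localTrivAt z) (s x)).2) z := by
    refine ((B.localTrivAt z).continuousAt ?_).comp s.continuous.continuousAt |>.snd
    rw [B.mem_localTrivAt_source, hsx]
    exact B.mem_localTrivAt_baseSet z
  have htriv : ∀ x, ((B.localTrivAt z) (s x)).2 = d x z * θ x := fun x => by
    have h : ((B.localTrivAt z) (s x)).2 = d (s x).1 z * (d (s x).1 (s x).1)⁻¹ * θ x := rfl
    rw [h, hsx, (hdN x).self (mem_of_mem_nhds (hN x)), inv_one, mul_one]
  simp only [htriv, ContinuousAt, nhds_discrete, tendsto_pure] at hcont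
  refine ⟨_, inter_mem (hN z) hcont, fun u hu v hv => ?_⟩
  have huv : d u z * θ u = d v z * θ v := hu.2.trans hv.2.symm
  rw [← hdN z hu.1 hv.1 hz, mul_assoc, mul_right_inj] at huv
  exact huv.symm

namespace IsLocalCocycle

variable [SimplyConnectedSpace Z] [LocallyPathConnectedSpace Z]

/-- The increment from `u` to `v` of the primitives of a local cocycle on a simply connected
space. -/
noncomputable def integral (hd : IsLocalCocycle d) (u v : Z) : G :=
  hd.exists_isPrimitive.choose v * (hd.exists_isPrimitive.choose u)⁻¹

theorem integral_eq_of_isPrimitive (hd : IsLocalCocycle d) {θ : Z → G} (hθ : IsPrimitive d θ)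
    (u v : Z) : hd.integral u v = θ v * (θ u)⁻¹ :=
  hd.exists_isPrimitive.choose_spec.mul_inv_eq hθ u v

theorem integral_mul_integral (hd : IsLocalCocycle d) (u v w : Z) :
    hd.integral v w * hd.integral u v = hd.integral u w := by
  simp only [integral]
  group

theorem integral_comp [SimplyConnectedSpace Z'] [LocallyPathConnectedSpace Z']
    (hd : IsLocalCocycle d) {h : Z' → Z} (hh : Continuous h) (u v : Z') :
    (hd.comp hh).integral u v = hd.integral (h u) (h v) :=
  integral_eq_of_isPrimitive _ (hd.exists_isPrimitive.choose_spec.comp hh) u v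

theorem integral_eq_of_isCocycleOn (hd : IsLocalCocycle d) {K : Set Z} (hK : IsPreconnected K)
    (hdK : IsCocycleOn d K) {u v : Z} (hu : u ∈ K) (hv : v ∈ K) : hd.integral u v = d u v := by
  have _ : PreconnectedSpace K := isPreconnected_iff_preconnectedSpace.1 hK
  have hd_prim : IsPrimitive (fun x y : K => d x y) fun x : K => d u x := fun _ =>
    ⟨Set.univ, univ_mem, fun x _ y _ => (hdK hu x.2 y.2).symm⟩
  have hint := hd.exists_isPrimitive.choose_spec.comp (continuous_subtype_val (p := (· ∈ K)))
  simpa [integral, hdK.self hu] using hint.mul_inv_eq hd_prim ⟨u, hu⟩ ⟨v, hv⟩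

end IsLocalCocycle

end Cocycle

section FreeProduct

open Monoid Monoid.CoprodI
open scoped commutatorElement

open scoped Classical in
/-- The number of letters of the reduced word representing an element of a free product. -/
noncomputable def wordLength {ι : Type*} {M : ι → Type*} [∀ i, Monoid (M i)] (g : CoprodI M) : ℕ :=
  (Word.equiv g).toList.length

variable {ι : Type*} {M : ι → Type*} [∀ i, Monoid (M i)]

theorem wordLength_prod (w : Word M) : wordLength w.prod = w.toList.length := by
  classical
  have h : Word.equiv w.prod = w := Word.equiv.apply_symm_apply w
  rw [← congrArg (fun w : Word M => w.toList.length) h]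
  unfold wordLength
  congr!

theorem wordLength_one : wordLength (1 : CoprodI M) = 0 :=
  wordLength_prod Word.empty

open scoped Classical in
theorem length_rcons_le {i : ι} (P : Word.Pair M i) :
    (Word.rcons P).toList.length ≤ P.tail.toList.length + 1 := by
  unfold Word.rcons
  split_ifs <;> simp [Word.cons]

open scoped Classical in
theorem length_tail_le {i : ι} (P : Word.Pair M i) :
    P.tail.toList.length ≤ (Word.rcons P).toList.length := by
  unfold Word.rcons
  split_ifs <;> simp [Word.cons]

theorem wordLength_of_mul_le {i : ι} (m : M i) (g : CoprodI M) :
    wordLength (of m * g) ≤ wordLength g + 1 := by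
  classical
  obtain ⟨w, rfl⟩ := Word.equiv.symm.surjective g
  obtain ⟨P, rfl⟩ := (Word.equivPair i).symm.surjective w
  have h : of m * (Word.rcons P).prod = (Word.rcons { P with head := m * P.head }).prod := by
    simp only [Word.prod_rcons, map_mul, mul_assoc]
  change wordLength (of m * (Word.rcons P).prod) ≤ wordLength (Word.rcons P).prod + 1
  rw [h, wordLength_prod, wordLength_prod]
  exact (length_rcons_le _).trans (Nat.succ_le_succ (length_tail_le P))

theorem wordLength_commutator_pow {G : ι → Type*} [∀ i, Group (G i)] {i j : ι} (hij : i ≠ j)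
    {a : G i} {b : G j} (ha : a ≠ 1) (hb : b ≠ 1) (k : ℕ) :
    wordLength (⁅(of a : CoprodI G), of b⁆ ^ k) = 4 * k := by
  let c : NeWord G i j := ((NeWord.singleton a ha).append hij (NeWord.singleton b hb)).append
    hij.symm ((NeWord.singleton a⁻¹ (inv_ne_one.2 ha)).append hij
      (NeWord.singleton b⁻¹ (inv_ne_one.2 hb)))
  have hc : c.prod = ⁅(of a : CoprodI G), of b⁆ := by
    simp [c, commutatorElement_def, mul_assoc]
  have hpow : ∀ n, ∃ w : NeWord G i j,
      w.prod = ⁅(of a : CoprodI G), of b⁆ ^ (n + 1) ∧ w.toList.length = 4 * (n + 1) := by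
    intro n
    induction n with
    | zero => exact ⟨c, by rw [hc, zero_add, pow_one], rfl⟩
    | succ n ih =>
      obtain ⟨w, hw, hlen⟩ := ih
      refine ⟨w.append hij.symm c, by rw [NeWord.append_prod, hw, hc, ← pow_succ], ?_⟩
      rw [NeWord.toList, List.length_append, hlen]
      rfl
  cases k with
  | zero => rw [pow_zero, wordLength_one, mul_zero]
  | succ n =>
    obtain ⟨w, hw, hlen⟩ := hpow n
    rw [← hw, ← hlen]
    exact wordLength_prod w.toWord

end FreeProduct

open CategoryTheory

instance : ContractibleSpace unitInterval :=
  (convex_Icc (0 : ℝ) 1).contractibleSpace ⟨0, by simp⟩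

instance : LocallyPathConnectedSpace unitInterval :=
  (convex_Icc (0 : ℝ) 1).locallyPathConnectedSpace

section FundamentalGroupoid

open FundamentalGroupoid

variable {A Z Z' : Type*} [TopologicalSpace A] [TopologicalSpace Z] [TopologicalSpace Z'] {a : A}

/-- The class of the image under `F` of a path from `u` to `v`, closed up to a loop at `a` by means
of the anchors `γ`. -/
noncomputable def pathCocycle [PathConnectedSpace Z] (γ : ∀ x : FundamentalGroupoid A, mk a ⟶ x)
    (F : C(Z, A)) (u v : Z) : FundamentalGroup A a :=
  γ ((map F).obj (mk u)) ≫ (map F).map (fromPath (.mk (PathConnectedSpace.somePath u v))) ≫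
    inv (γ ((map F).obj (mk v)))

variable (γ : ∀ x : FundamentalGroupoid A, mk a ⟶ x)

theorem pathCocycle_eq [SimplyConnectedSpace Z] (F : C(Z, A)) {u v : Z}
    (f : Path.Homotopic.Quotient u v) :
    pathCocycle γ F u v = γ ((map F).obj (mk u)) ≫ (map F).map (fromPath f) ≫
      inv (γ ((map F).obj (mk v))) := by
  rw [pathCocycle, Subsingleton.elim (.mk _) f]

theorem pathCocycle_mul_pathCocycle [SimplyConnectedSpace Z] (F : C(Z, A)) (u v w : Z) :
    pathCocycle γ F v w * pathCocycle γ F u v = pathCocycle γ F u w := by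
  let f := Path.Homotopic.Quotient.mk (PathConnectedSpace.somePath u v)
  let g := Path.Homotopic.Quotient.mk (PathConnectedSpace.somePath v w)
  have hfg : fromPath (f.trans g) = fromPath f ≫ fromPath g := rfl
  rw [pathCocycle_eq γ F f, pathCocycle_eq γ F g, pathCocycle_eq γ F (f.trans g), hfg,
    Functor.map_comp, End.mul_def]
  simp only [Category.assoc, IsIso.inv_hom_id_assoc]

theorem pathCocycle_comp [SimplyConnectedSpace Z] [SimplyConnectedSpace Z'] (F : C(Z, A))
    (h : C(Z', Z)) (u v : Z') :
    pathCocycle γ (F.comp h) u v = pathCocycle γ F (h u) (h v) := by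
  let f := Path.Homotopic.Quotient.mk (PathConnectedSpace.somePath u v)
  rw [pathCocycle_eq γ F (f.map h)]
  rfl

theorem pathCocycle_toContinuousMap {x y : A} (g : Path x y) :
    (pathCocycle γ g.toContinuousMap 0 1 : mk a ⟶ mk a) =
      γ (mk x) ≫ fromPath (.mk g) ≫ inv (γ (mk y)) := by
  rcases g with ⟨F, rfl, rfl⟩
  rw [pathCocycle_eq γ _ (.mk Path.id)]
  rfl

end FundamentalGroupoid

/-- A subset of `A` containing the base point `a` whose paths are determined up to homotopy in `A`
by their end points, together with path classes from `a` to all points of `A` that witness this. -/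
structure AnchoredSet {A : Type*} [TopologicalSpace A] (a : A) where
  carrier : Set A
  base_mem : a ∈ carrier
  anchor : ∀ x : FundamentalGroupoid A, FundamentalGroupoid.mk a ⟶ x
  anchor_base : anchor (.mk a) = 𝟙 (FundamentalGroupoid.mk a)
  anchor_comp : ∀ {x y : A} (f : Path x y), (∀ t, f t ∈ carrier) →
    anchor (.mk x) ≫ FundamentalGroupoid.fromPath (.mk f) = anchor (.mk y)

namespace AnchoredSet

open FundamentalGroupoid (fromPath)

variable {A Z : Type*} [TopologicalSpace A] [TopologicalSpace Z] {a : A}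

open Classical in
/-- A simply connected subset of a path connected space is anchored at each of its points. -/
noncomputable def ofIsSimplyConnected [PathConnectedSpace A] {V : Set A}
    (hV : IsSimplyConnected V) (ha : a ∈ V) : AnchoredSet a :=
  have : SimplyConnectedSpace V := hV
  let incl : C(V, A) := ⟨(↑), continuous_subtype_val⟩
  let γ (x : A) : FundamentalGroupoid.mk a ⟶ FundamentalGroupoid.mk x := if hx : x ∈ V
    then (FundamentalGroupoid.map incl).map
      (fromPath (.mk (PathConnectedSpace.somePath (⟨a, ha⟩ : V) ⟨x, hx⟩)))
    else fromPath (.mk (PathConnectedSpace.somePath a x))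
  have γ_eq {x : A} (hx : x ∈ V) (f : Path.Homotopic.Quotient (⟨a, ha⟩ : V) ⟨x, hx⟩) :
      γ x = (FundamentalGroupoid.map incl).map (fromPath f) := by
    rw [Subsingleton.elim f]
    exact dif_pos hx
  { carrier := V
    base_mem := ha
    anchor x := γ x.as
    anchor_base := (γ_eq ha (.refl _)).trans (CategoryTheory.Functor.map_id _ _)
    anchor_comp {x y} f hf := by
      have hx : x ∈ V := f.source ▸ hf 0
      have hy : y ∈ V := f.target ▸ hf 1
      let f' : Path (⟨x, hx⟩ : V) ⟨y, hy⟩ :=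
        ⟨⟨fun t => ⟨f t, hf t⟩, by fun_prop⟩, by simp, by simp⟩
      let g := Path.Homotopic.Quotient.mk (PathConnectedSpace.somePath (⟨a, ha⟩ : V) ⟨x, hx⟩)
      have hgf := (FundamentalGroupoid.map incl).map_comp (fromPath g) (fromPath (.mk f'))
      rw [← γ_eq hx g] at hgf
      exact hgf.symm.trans (γ_eq hy (g.trans (.mk f'))).symm }

theorem pathCocycle_eq_one [SimplyConnectedSpace Z] (V : AnchoredSet a) {F : C(Z, A)}
    {S : Set Z} (hS : IsPathConnected S) (hF : Set.MapsTo F S V.carrier) {u v : Z} (hu : u ∈ S)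
    (hv : v ∈ S) : pathCocycle V.anchor F u v = 1 := by
  obtain ⟨f, hf⟩ := hS.joinedIn u hu v hv
  have hanchor := V.anchor_comp (f.map F.continuous) fun t => hF (hf t)
  rw [pathCocycle_eq _ _ (.mk f), ← Category.assoc]
  exact (IsIso.comp_inv_eq _).2 (hanchor.trans (Category.id_comp _).symm)

theorem pathCocycle_toContinuousMap (V : AnchoredSet a) (g : Path a a) :
    pathCocycle V.anchor g.toContinuousMap 0 1 = FundamentalGroup.fromPath (.mk g) := by
  refine (_root_.pathCocycle_toContinuousMap V.anchor g).trans ?_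
  simp only [V.anchor_base, IsIso.inv_id, Category.id_comp, Category.comp_id]

end AnchoredSet

/-- Two maps out of `X` such that near each point of `X` at least one of them takes its values in an
anchored set, as for the projections of the wedge of two locally simply connected spaces. -/
structure CollapsePair {X : Type*} [TopologicalSpace X] (p : X) {A : Bool → Type*}
    [∀ b, TopologicalSpace (A b)] (a : ∀ b, A b) where
  toMap : ∀ b, C(X, A b)
  map_base : ∀ b, toMap b p = a b
  core : ∀ b, AnchoredSet (a b)
  exists_preimage_core_mem_nhds : ∀ x, ∃ b, toMap b ⁻¹' (core b).carrier ∈ 𝓝 x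

section FreeFundamentalGroup

open Monoid (CoprodI)

variable {A : Bool → Type*} [∀ b, TopologicalSpace (A b)]

/-- The free product of the fundamental groups of two spaces, which stands in for the fundamental
group of their wedge. -/
abbrev FreeFundamentalGroup (a : ∀ b, A b) : Type _ :=
  CoprodI fun b => FundamentalGroup (A b) (a b)

/-- The inclusion of one of the two fundamental groups into their free product. -/
noncomputable abbrev letter (a : ∀ b, A b) (b : Bool) :
    FundamentalGroup (A b) (a b) →* FreeFundamentalGroup a :=
  CoprodI.of (M := fun b => FundamentalGroup (A b) (a b)) (i := b)

end FreeFundamentalGroup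

namespace CollapsePair

open scoped unitInterval

variable {X Z Z' : Type*} [TopologicalSpace X] [TopologicalSpace Z] [TopologicalSpace Z'] {p : X}
  {A : Bool → Type*} [∀ b, TopologicalSpace (A b)] {a : ∀ b, A b}
  [SimplyConnectedSpace Z] [SimplyConnectedSpace Z'] (P : CollapsePair p a)

/-- The product, in the free product of the two fundamental groups, of the cocycles of the two
maps. It is a cocycle where one of the factors vanishes. -/
noncomputable def cocycle (F : C(Z, X)) (u v : Z) : FreeFundamentalGroup a :=
  letter a false (pathCocycle (P.core false).anchor ((P.toMap false).comp F) u v) *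
    letter a true (pathCocycle (P.core true).anchor ((P.toMap true).comp F) u v)

theorem cocycle_comp (F : C(Z, X)) (h : C(Z', Z)) (u v : Z') :
    P.cocycle (F.comp h) u v = P.cocycle F (h u) (h v) := by
  simp only [cocycle, ← ContinuousMap.comp_assoc, pathCocycle_comp]

section Core

variable {F : C(Z, X)} {S : Set Z} {b : Bool} {u v : Z}

theorem cocycle_eq_of (hS : IsPathConnected S)
    (hF : Set.MapsTo (P.toMap b ∘ F) S (P.core b).carrier) (hu : u ∈ S) (hv : v ∈ S) :
    P.cocycle F u v =
      letter a (!b) (pathCocycle (P.core !b).anchor ((P.toMap !b).comp F) u v) := by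
  have hone := (P.core b).pathCocycle_eq_one (F := (P.toMap b).comp F) hS hF hu hv
  cases b
  · rw [cocycle, hone, map_one, one_mul, Bool.not_false]
  · rw [cocycle, hone, map_one, mul_one, Bool.not_true]

theorem isCocycleOn (hS : IsPathConnected S)
    (hF : Set.MapsTo (P.toMap b ∘ F) S (P.core b).carrier) : IsCocycleOn (P.cocycle F) S := by
  intro u hu v hv w hw
  rw [P.cocycle_eq_of hS hF hv hw, P.cocycle_eq_of hS hF hu hv, P.cocycle_eq_of hS hF hu hw,
    ← map_mul, pathCocycle_mul_pathCocycle]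

end Core

variable [LocallyPathConnectedSpace Z] [LocallyPathConnectedSpace Z']

theorem isLocalCocycle (F : C(Z, X)) : IsLocalCocycle (P.cocycle F) := by
  intro z
  obtain ⟨b, hb⟩ := P.exists_preimage_core_mem_nhds (F z)
  obtain ⟨S, ⟨hSz, hS⟩, hSF⟩ := (LocallyPathConnectedSpace.path_connected_basis z).mem_iff.1
    (F.continuous.continuousAt hb)
  exact ⟨S, hSz, P.isCocycleOn hS hSF⟩

/-- The element of the free product spelled by the image under `F` of the paths from `u` to `v`. -/
noncomputable def holonomy (F : C(Z, X)) (u v : Z) : FreeFundamentalGroup a :=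
  (P.isLocalCocycle F).integral u v

theorem holonomy_mul_holonomy (F : C(Z, X)) (u v w : Z) :
    P.holonomy F v w * P.holonomy F u v = P.holonomy F u w :=
  (P.isLocalCocycle F).integral_mul_integral u v w

theorem holonomy_comp (F : C(Z, X)) (h : C(Z', Z)) (u v : Z') :
    P.holonomy (F.comp h) u v = P.holonomy F (h u) (h v) := by
  have hcomp : P.cocycle (F.comp h) = fun u v => P.cocycle F (h u) (h v) :=
    funext₂ (P.cocycle_comp F h)
  simp only [holonomy, hcomp]
  exact (P.isLocalCocycle F).integral_comp h.continuous u v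

section Core

variable {F : C(Z, X)} {S : Set Z} {b : Bool} {u v : Z}

theorem holonomy_eq_of (hS : IsPathConnected S)
    (hF : Set.MapsTo (P.toMap b ∘ F) S (P.core b).carrier) (hu : u ∈ S) (hv : v ∈ S) :
    P.holonomy F u v =
      letter a (!b) (pathCocycle (P.core !b).anchor ((P.toMap !b).comp F) u v) := by
  rw [← P.cocycle_eq_of hS hF hu hv]
  exact (P.isLocalCocycle F).integral_eq_of_isCocycleOn hS.isConnected.isPreconnected
    (P.isCocycleOn hS hF) hu hv

theorem holonomy_eq_one (hS : IsPathConnected S) (hF : ∀ z ∈ S, F z = p) (hu : u ∈ S)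
    (hv : v ∈ S) : P.holonomy F u v = 1 := by
  have hcore (b : Bool) : Set.MapsTo (P.toMap b ∘ F) S (P.core b).carrier := fun z hz => by
    rw [Function.comp_apply, hF z hz, P.map_base]
    exact (P.core b).base_mem
  rw [P.holonomy_eq_of hS (hcore true) hu hv,
    (P.core _).pathCocycle_eq_one (F := (P.toMap _).comp F) hS (hcore _) hu hv, map_one]

end Core

theorem holonomy_eq_of_homotopic {f g : Path p p} (h : f.Homotopic g) :
    P.holonomy f.toContinuousMap 0 1 = P.holonomy g.toContinuousMap 0 1 := by
  obtain ⟨H⟩ := h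
  let F : C(I × I, X) := H.toContinuousMap
  have hside (t : I) (ht : ∀ s, F (s, t) = p) : P.holonomy F (0, t) (1, t) = 1 :=
    P.holonomy_eq_one (isPathConnected_range (f := fun s : I => (s, t)) (by fun_prop))
      (Set.forall_mem_range.2 ht) ⟨0, rfl⟩ ⟨1, rfl⟩
  have hslice (s : I) (f : Path p p) (hf : ∀ t, F (s, t) = f t) :
      P.holonomy f.toContinuousMap 0 1 = P.holonomy F (s, 0) (s, 1) := by
    let h : C(I, I × I) := ⟨fun t => (s, t), by fun_prop⟩
    have hfh : f.toContinuousMap = F.comp h := ContinuousMap.ext fun t => (hf t).symm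
    rw [hfh]
    exact P.holonomy_comp F h 0 1
  rw [hslice 0 f H.apply_zero, hslice 1 g H.apply_one]
  have hsquare := (P.holonomy_mul_holonomy F (0, 0) (0, 1) (1, 1)).trans
    (P.holonomy_mul_holonomy F (0, 0) (1, 0) (1, 1)).symm
  rwa [hside 1 H.target, hside 0 H.source, one_mul, mul_one] at hsquare

theorem holonomy_trans (f g : Path p p) : P.holonomy (f.trans g).toContinuousMap 0 1 =
    P.holonomy g.toContinuousMap 0 1 * P.holonomy f.toContinuousMap 0 1 := by
  let F : C(ℝ, X) := ⟨(f.trans g).extend, (f.trans g).continuous_extend⟩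
  have hpiece (q : Path p p) (h : C(I, ℝ)) (hq : ∀ t, q t = F (h t)) :
      P.holonomy q.toContinuousMap 0 1 = P.holonomy F (h 0) (h 1) := by
    rw [← P.holonomy_comp F h, show q.toContinuousMap = F.comp h from ContinuousMap.ext hq]
  let left : C(I, ℝ) := ⟨fun t => t / 2, by fun_prop⟩
  let right : C(I, ℝ) := ⟨fun t => (t + 1) / 2, by fun_prop⟩
  have hleft (t : I) : f t = F (left t) := by
    have ht : (t / 2 : ℝ) ≤ 1 / 2 := by linarith [t.2.2]
    change f t = (f.trans g).extend (t / 2)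
    rw [Path.extend_trans_of_le_half _ _ ht, mul_div_cancel₀ _ two_ne_zero]
    exact (f.extend_apply t.2).symm
  have hright (t : I) : g t = F (right t) := by
    have ht : (1 / 2 : ℝ) ≤ (t + 1) / 2 := by linarith [t.2.1]
    change g t = (f.trans g).extend ((t + 1) / 2)
    rw [Path.extend_trans_of_half_le _ _ ht, mul_div_cancel₀ _ two_ne_zero, add_sub_cancel_right]
    exact (g.extend_apply t.2).symm
  have hmid : right 0 = left 1 := by simp [left, right]
  have hzero : left 0 = 0 := by simp [left]
  have hone : right 1 = 1 := by simp [right]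
  rw [hpiece f left hleft, hpiece g right hright, hmid, hzero, hone, P.holonomy_mul_holonomy]
  exact hpiece (f.trans g) ⟨(↑), by fun_prop⟩ fun t => ((f.trans g).extend_apply t.2).symm

/-- The homomorphism from the fundamental group of `X` to the free product induced by a collapse
pair. -/
noncomputable def spell :
    FundamentalGroup X p →* FreeFundamentalGroup a :=
  MonoidHom.mk' (Quotient.lift (fun f => P.holonomy f.toContinuousMap 0 1) fun _ _ =>
    P.holonomy_eq_of_homotopic) fun x y => by
      obtain ⟨f, rfl⟩ := Path.Homotopic.Quotient.mk_surjective x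
      obtain ⟨g, rfl⟩ := Path.Homotopic.Quotient.mk_surjective y
      exact P.holonomy_trans g f

theorem spell_eq_of {b : Bool} (f : Path p p) (g : Path (a b) (a b))
    (hg : ∀ t, P.toMap b (f t) = g t) (hbase : ∀ t, P.toMap (!b) (f t) = a !b) :
    P.spell (FundamentalGroup.fromPath (.mk f)) =
      letter a b (FundamentalGroup.fromPath (.mk g)) := by
  have hcore : Set.MapsTo (P.toMap (!b) ∘ f.toContinuousMap) Set.univ (P.core !b).carrier :=
    fun t _ => by
      change P.toMap (!b) (f t) ∈ (P.core !b).carrier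
      rw [hbase]
      exact (P.core !b).base_mem
  have hcomp : (P.toMap b).comp f.toContinuousMap = g.toContinuousMap := ContinuousMap.ext hg
  rw [← (P.core b).pathCocycle_toContinuousMap g, ← hcomp]
  refine (P.holonomy_eq_of isPathConnected_univ hcore (Set.mem_univ 0) (Set.mem_univ 1)).trans ?_
  rw [Bool.not_not]

theorem wordLength_spell_le {f : Path p p} {t : ℕ → I} (ht : Monotone t) (ht_zero : t 0 = 0)
    {n : ℕ} (htn : t n = 1) (hf : ∀ m < n, ∃ b, Set.MapsTo (P.toMap b ∘ f)
      (Set.Icc (t m) (t (m + 1))) (P.core b).carrier) :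
    wordLength (P.spell (FundamentalGroup.fromPath (.mk f))) ≤ n := by
  have hle : ∀ m ≤ n, wordLength (P.holonomy f.toContinuousMap (t 0) (t m)) ≤ m := by
    intro m
    induction m with
    | zero =>
      intro _
      have hself := P.holonomy_mul_holonomy f.toContinuousMap (t 0) (t 0) (t 0)
      rw [mul_eq_left.1 hself, wordLength_one]
    | succ m ih =>
      intro hm
      obtain ⟨b, hb⟩ := hf m hm
      have htm : t m ≤ t (m + 1) := ht m.le_succ
      have hIcc : IsPathConnected (Set.Icc (t m) (t (m + 1))) :=
        ((convex_Icc (t m : ℝ) (t (m + 1))).isPathConnected ⟨t m, le_rfl, htm⟩).preimage_coe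
          (U := I) fun s hs => ⟨(t m).2.1.trans hs.1, hs.2.trans (t (m + 1)).2.2⟩
      rw [← P.holonomy_mul_holonomy _ (t 0) (t m),
        P.holonomy_eq_of hIcc hb (Set.left_mem_Icc.2 htm) (Set.right_mem_Icc.2 htm)]
      exact (wordLength_of_mul_le _ _).trans (Nat.succ_le_succ (ih (Nat.le_of_succ_le hm)))
  have hspell := hle n le_rfl
  rwa [ht_zero, htn] at hspell

end CollapsePair

section Loops

open Path.Homotopic.Quotient (mk)
open scoped unitInterval commutatorElement

variable {X : Type*} [TopologicalSpace X] {p : X}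

/-- A loop representing the `k`-th power of the commutator of the classes of two loops. -/
noncomputable def commutatorPow (f g : Path p p) : ℕ → Path p p
  | 0 => Path.refl p
  | k + 1 => (g.symm.trans (f.symm.trans (g.trans f))).trans (commutatorPow f g k)

theorem fromPath_mk_commutatorPow (f g : Path p p) (k : ℕ) :
    FundamentalGroup.fromPath (mk (commutatorPow f g k)) =
      ⁅FundamentalGroup.fromPath (mk f), FundamentalGroup.fromPath (mk g)⁆ ^ k := by
  induction k with
  | zero => rfl
  | succ k ih => rw [pow_succ, ← ih]; rfl

theorem continuous_commutatorPow (f : Path p p) (k : ℕ) :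
    Continuous fun g => commutatorPow f g k := by
  induction k with
  | zero => exact continuous_const
  | succ k ih =>
    exact (Path.continuous_symm.path_trans (continuous_const.path_trans
      (continuous_id.path_trans continuous_const))).path_trans ih

theorem commutatorPow_refl_homotopic (f : Path p p) (k : ℕ) :
    (commutatorPow f (Path.refl p) k).Homotopic (Path.refl p) := by
  have hrefl : FundamentalGroup.fromPath (mk (Path.refl p)) = 1 := rfl
  refine Path.Homotopic.Quotient.eq.1 ((fromPath_mk_commutatorPow f _ k).trans ?_)
  rw [hrefl, commutatorElement_one_right, one_pow, ← hrefl]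

theorem nontrivial_fundamentalGroup [PathConnectedSpace X] (hX : ¬ SimplyConnectedSpace X)
    (p : X) : Nontrivial (FundamentalGroup X p) := by
  refine not_subsingleton_iff_nontrivial.1 fun _ =>
    hX (simply_connected_iff_loops_nullhomotopic.2 ⟨inferInstance, fun x f => ?_⟩)
  have hx : Subsingleton (FundamentalGroup X x) :=
    (FundamentalGroup.fundamentalGroupMulEquivOfPathConnected x p).toEquiv.subsingleton
  exact Path.Homotopic.Quotient.eq.1 (hx.elim (.mk f) (.refl x))

theorem joined_iff_homotopic {x y : X} {f g : Path x y} : Joined f g ↔ f.Homotopic g := by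
  constructor
  · rintro ⟨Φ⟩
    have hΦ : Continuous fun st : I × I => Φ st.1 st.2 :=
      Path.continuous_uncurry_iff.2 Φ.continuous
    exact ⟨{ toFun := fun st => Φ st.1 st.2
             continuous_toFun := hΦ
             map_zero_left := by simp
             map_one_left := by simp
             prop' := by rintro s t (rfl | rfl) <;> simp }⟩
  · rintro ⟨H⟩
    exact ⟨{ toFun := H.eval
             continuous_toFun := Path.continuous_uncurry_iff.1 H.continuous
             source' := H.eval_zero
             target' := H.eval_one }⟩

end Loops

theorem LocallySimplyConnectedAt.exists_anchoredSet {Z : Type*} [TopologicalSpace Z]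
    [PathConnectedSpace Z] {z : Z} (hz : LocallySimplyConnectedAt z) :
    ∃ V : AnchoredSet z, V.carrier ∈ 𝓝 z := by
  obtain ⟨V, hV, -, hV_sc⟩ := hz Set.univ Filter.univ_mem
  exact ⟨.ofIsSimplyConnected hV_sc (mem_of_mem_nhds hV), hV⟩

namespace IsHawaiianDecomposition

open Filter
open scoped unitInterval

variable {X : Type*} [MetricSpace X] {p : X} {Y : ℕ → Set X}

theorem base_mem (h : IsHawaiianDecomposition p Y) (n : ℕ) : p ∈ Y n := by
  have hp : p ∈ Y n ∩ Y (n + 1) := by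
    rw [h.inter_eq n (n + 1) n.lt_succ_self.ne]
    rfl
  exact hp.1

theorem eq_base (h : IsHawaiianDecomposition p Y) {n m : ℕ} (hnm : n ≠ m) {x : X} (hn : x ∈ Y n)
    (hm : x ∈ Y m) : x = p := by
  have hx : x ∈ Y n ∩ Y m := ⟨hn, hm⟩
  rwa [h.inter_eq n m hnm] at hx

theorem exists_mem (h : IsHawaiianDecomposition p Y) (x : X) : ∃ n, x ∈ Y n :=
  Set.mem_iUnion.1 (h.iUnion_eq ▸ Set.mem_univ x)

theorem eventually_subset (h : IsHawaiianDecomposition p Y) {U : Set X} (hU : U ∈ 𝓝 p) :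
    ∀ᶠ n in atTop, Y n ⊆ U := by
  obtain ⟨ε, hε, hεU⟩ := EMetric.mem_nhds_iff.1 hU
  filter_upwards [h.tendsto_diam.eventually (gt_mem_nhds hε)] with n hn x hx
  exact hεU ((Metric.edist_le_ediam_of_mem hx (h.base_mem n)).trans_lt hn)

theorem mem_nhds (h : IsHawaiianDecomposition p Y) {x : X} (hx : x ≠ p) {m : ℕ} (hm : x ∈ Y m) :
    Y m ∈ 𝓝 x := by
  obtain ⟨U, V, hU, hV, hUV⟩ := t2_separation_nhds hx
  obtain ⟨N, hN⟩ := eventually_atTop.1 (h.eventually_subset hV)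
  have hsmall : ∀ᶠ y in 𝓝 x, ∀ n ∈ Finset.range N, n ≠ m → y ∉ Y n := by
    refine (eventually_all_finset _).2 fun n _ => eventually_imp_distrib_left.2 fun hnm => ?_
    exact (h.isClosed n).isOpen_compl.mem_nhds fun hn => hx (h.eq_base hnm hn hm)
  filter_upwards [hsmall, hU] with y hy hyU
  obtain ⟨n, hn⟩ := h.exists_mem y
  by_contra hym
  have hnm : n ≠ m := fun hnm => hym (hnm ▸ hn)
  have hNn : N ≤ n := not_lt.1 fun hnN => hy n (Finset.mem_range.2 hnN) hnm hn
  exact hUV.notMem_of_mem_left hyU (hN n hNn hn)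

theorem pathConnectedSpace (h : IsHawaiianDecomposition p Y) (n : ℕ) : PathConnectedSpace (Y n) :=
  isPathConnected_iff_pathConnectedSpace.1 (h.isPathConnected n)

/-- The distinguished point as a point of a piece. -/
abbrev base (h : IsHawaiianDecomposition p Y) (n : ℕ) : Y n :=
  ⟨p, h.base_mem n⟩

open Classical in
/-- The retraction onto a piece that collapses the other pieces to the distinguished point. -/
noncomputable def collapse (h : IsHawaiianDecomposition p Y) (n : ℕ) : C(X, Y n) where
  toFun x := if hx : x ∈ Y n then ⟨x, hx⟩ else h.base n
  continuous_toFun := by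
    have hfrontier : ∀ x ∈ frontier (Y n), id x = p := fun x hx => by_contra fun hxp =>
      hx.2 (mem_interior_iff_mem_nhds.2 (h.mem_nhds hxp ((h.isClosed n).frontier_subset hx)))
    have hpiecewise := continuous_id.piecewise hfrontier continuous_const
    refine continuous_induced_rng.2 (hpiecewise.congr fun x => ?_)
    by_cases hx : x ∈ Y n <;> simp [hx]

theorem collapse_coe (h : IsHawaiianDecomposition p Y) {n : ℕ} (x : Y n) : h.collapse n x = x :=
  dif_pos x.2

theorem collapse_of_notMem (h : IsHawaiianDecomposition p Y) {n : ℕ} {x : X} (hx : x ∉ Y n) :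
    h.collapse n x = h.base n :=
  dif_neg hx

theorem collapse_of_mem_of_ne (h : IsHawaiianDecomposition p Y) {n m : ℕ} (hnm : n ≠ m) {x : X}
    (hx : x ∈ Y m) : h.collapse n x = h.base n := by
  by_cases hn : x ∈ Y n
  · obtain rfl := h.eq_base hnm hn hx
    exact h.collapse_coe (h.base n)
  · exact h.collapse_of_notMem hn

/-- A neighbourhood of the distinguished point in a piece, with anchors. -/
noncomputable def core (h : IsHawaiianDecomposition p Y) (n : ℕ) : AnchoredSet (h.base n) :=
  have := h.pathConnectedSpace n
  (h.locallySimplyConnectedAt n (h.base_mem n)).exists_anchoredSet.choose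

theorem preimage_core_mem_nhds (h : IsHawaiianDecomposition p Y) (n : ℕ) :
    h.collapse n ⁻¹' (h.core n).carrier ∈ 𝓝 p := by
  have := h.pathConnectedSpace n
  have hcore : (h.core n).carrier ∈ 𝓝 (h.base n) :=
    (h.locallySimplyConnectedAt n (h.base_mem n)).exists_anchoredSet.choose_spec
  refine (h.collapse n).continuous.continuousAt ?_
  rwa [h.collapse_coe (h.base n)]

theorem subset_or_subset_compl (h : IsHawaiianDecomposition p Y) {C : Set X}
    (hC : IsPreconnected C) (hp : p ∉ C) (n : ℕ) : C ⊆ Y n ∨ C ⊆ (Y n)ᶜ := by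
  have hcover : C ⊆ interior (Y n) ∪ (Y n)ᶜ := fun x hx => or_iff_not_imp_right.2 fun hxn =>
    mem_interior_iff_mem_nhds.2 (h.mem_nhds (ne_of_mem_of_not_mem hx hp) (not_not.1 hxn))
  have hdisjoint : Disjoint (interior (Y n)) (Y n)ᶜ :=
    disjoint_compl_right.mono_left interior_subset
  exact (hC.subset_or_subset isOpen_interior (h.isClosed n).isOpen_compl hdisjoint hcover).imp_left
    fun hCn => hCn.trans interior_subset

section CollapsePair

variable {s : Bool → ℕ}

theorem exists_mapsTo_core (h : IsHawaiianDecomposition p Y) (hs : s.Injective) {C : Set X}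
    (hC : C ⊆ Y (s false) ∨ C ⊆ (Y (s false))ᶜ) :
    ∃ b, Set.MapsTo (h.collapse (s b)) C (h.core (s b)).carrier := by
  rcases hC with hC | hC
  · refine ⟨true, fun x hx => ?_⟩
    rw [h.collapse_of_mem_of_ne (hs.ne Bool.false_ne_true.symm) (hC hx)]
    exact (h.core _).base_mem
  · refine ⟨false, fun x hx => ?_⟩
    rw [h.collapse_of_notMem (hC hx)]
    exact (h.core _).base_mem

/-- The maps collapsing a space similar to the Hawaiian earring onto two of its pieces. -/
noncomputable def collapsePair (h : IsHawaiianDecomposition p Y) (hs : s.Injective) :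
    CollapsePair p fun b => h.base (s b) where
  toMap b := h.collapse (s b)
  map_base b := h.collapse_coe (h.base (s b))
  core b := h.core (s b)
  exists_preimage_core_mem_nhds x := by
    rcases eq_or_ne x p with rfl | hxp
    · exact ⟨false, h.preimage_core_mem_nhds _⟩
    by_cases hx : x ∈ Y (s false)
    · obtain ⟨b, hb⟩ := h.exists_mapsTo_core hs (.inl subset_rfl)
      exact ⟨b, mem_of_superset (h.mem_nhds hxp hx) hb⟩
    · obtain ⟨b, hb⟩ := h.exists_mapsTo_core hs (.inr subset_rfl)
      exact ⟨b, mem_of_superset ((h.isClosed _).isOpen_compl.mem_nhds hx) hb⟩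

theorem exists_eventually_wordLength_spell_le (h : IsHawaiianDecomposition p Y) (i : ℕ)
    (f : Path p p) : ∃ M, ∀ᶠ g in 𝓝 f, ∀ {s : Bool → ℕ} (hs : s.Injective), s false = i →
      wordLength ((h.collapsePair hs).spell (FundamentalGroup.fromPath (.mk g))) ≤ M := by
  let O (b : Bool) : Set X := bif b then {p}ᶜ else interior (h.collapse i ⁻¹' (h.core i).carrier)
  have hO (b : Bool) : IsOpen (O b) := by
    cases b
    exacts [isOpen_interior, isOpen_compl_singleton]
  have hcover (x : X) : ∃ b, x ∈ O b := by
    rcases eq_or_ne x p with rfl | hx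
    exacts [⟨false, mem_interior_iff_mem_nhds.2 (h.preimage_core_mem_nhds i)⟩, ⟨true, hx⟩]
  obtain ⟨t, ht_zero, ht, ⟨N, hN⟩, ht_cover⟩ := exists_monotone_Icc_subset_open_cover_unitInterval
    (fun b => (hO b).preimage f.continuous) fun u _ => Set.mem_iUnion.2 (hcover (f u))
  choose b hb using ht_cover
  have hnear : ∀ᶠ g : Path p p in 𝓝 f, ∀ m ∈ Finset.range N,
      Set.MapsTo g (Set.Icc (t m) (t (m + 1))) (O (b m)) :=
    (eventually_all_finset _).2 fun m _ => continuous_induced_dom.continuousAt.eventually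
      (ContinuousMap.eventually_mapsTo isCompact_Icc (hO (b m)) (hb m))
  refine ⟨N, hnear.mono fun g hg s hs hsi => ?_⟩
  refine (h.collapsePair hs).wordLength_spell_le ht ht_zero (hN N le_rfl) fun m hm => ?_
  have hgm := hg m (Finset.mem_range.2 hm)
  cases hbm : b m with
  | false =>
    subst hsi
    rw [hbm] at hgm
    have hsub : O false ⊆ h.collapse (s false) ⁻¹' (h.core (s false)).carrier := interior_subset
    exact ⟨false, fun u hu => hsub (hgm hu)⟩
  | true =>
    rw [hbm] at hgm
    have hp : p ∉ g '' Set.Icc (t m) (t (m + 1)) := fun ⟨u, hu, hup⟩ => hgm hu hup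
    obtain ⟨b, hb⟩ := h.exists_mapsTo_core hs
      (h.subset_or_subset_compl (isPreconnected_Icc.image g g.continuous.continuousOn) hp _)
    exact ⟨b, fun u hu => hb ⟨u, hu, rfl⟩⟩

end CollapsePair

section PieceLoop

/-- A loop in one of the pieces, as a loop in the whole space. -/
def pieceLoop (h : IsHawaiianDecomposition p Y) {n : ℕ} (f : Path (h.base n) (h.base n)) :
    Path p p :=
  f.map continuous_subtype_val

theorem tendsto_pieceLoop (h : IsHawaiianDecomposition p Y)
    (f : ∀ n, Path (h.base n) (h.base n)) :
    Tendsto (fun n => h.pieceLoop (f n)) atTop (𝓝 (Path.refl p)) := by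
  rw [nhds_induced, tendsto_comap_iff, ContinuousMap.tendsto_nhds_compactOpen]
  intro K _ U hU hKU
  rcases K.eq_empty_or_nonempty with rfl | ⟨t, ht⟩
  · exact .of_forall fun _ => Set.mapsTo_empty _ _
  · have hpU : p ∈ U := hKU ht
    filter_upwards [h.eventually_subset (hU.mem_nhds hpU)] with n hn t _ using hn (f n t).2

variable {s : Bool → ℕ}

theorem spell_pieceLoop (h : IsHawaiianDecomposition p Y) (hs : s.Injective) {b : Bool}
    (f : Path (h.base (s b)) (h.base (s b))) :
    (h.collapsePair hs).spell (FundamentalGroup.fromPath (.mk (h.pieceLoop f))) =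
      letter (fun b => h.base (s b)) b (FundamentalGroup.fromPath (.mk f)) :=
  (h.collapsePair hs).spell_eq_of _ f (fun t => h.collapse_coe (f t)) fun t =>
    h.collapse_of_mem_of_ne (hs.ne b.not_ne_self) (f t).2

theorem wordLength_spell_commutatorPow (h : IsHawaiianDecomposition p Y) (hs : s.Injective)
    (f : ∀ b, Path (h.base (s b)) (h.base (s b)))
    (hf : ∀ b, ¬ (f b).Homotopic (Path.refl _)) (k : ℕ) :
    wordLength ((h.collapsePair hs).spell (FundamentalGroup.fromPath
      (.mk (commutatorPow (h.pieceLoop (f false)) (h.pieceLoop (f true)) k)))) = 4 * k := by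
  have hne (b : Bool) : FundamentalGroup.fromPath (.mk (f b)) ≠ 1 := fun hb =>
    hf b (Path.Homotopic.Quotient.eq.1 hb)
  rw [fromPath_mk_commutatorPow, map_pow, map_commutatorElement, spell_pieceLoop, spell_pieceLoop]
  exact wordLength_commutator_pow Bool.false_ne_true (hne false) (hne true) k

theorem exists_not_homotopic_refl (h : IsHawaiianDecomposition p Y) (n : ℕ) :
    ∃ f : Path (h.base n) (h.base n), ¬ f.Homotopic (Path.refl _) := by
  have := h.pathConnectedSpace n
  have := nontrivial_fundamentalGroup (h.not_isSimplyConnected n) (h.base n)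
  obtain ⟨c, hc⟩ := exists_ne (1 : FundamentalGroup (Y n) (h.base n))
  obtain ⟨f, rfl⟩ := Path.Homotopic.Quotient.mk_surjective c
  exact ⟨f, fun hf => hc (Path.Homotopic.Quotient.eq.2 hf)⟩

end PieceLoop

end IsHawaiianDecomposition

namespace TopFundamentalGroup

variable {X Y : Type*} [TopologicalSpace X] [TopologicalSpace Y] {p : X}

/-- The class of a loop in the topological fundamental group. -/
def mk (f : Path p p) : TopFundamentalGroup X p :=
  ZerothHomotopy.mk f

theorem isQuotientMap_mk : IsQuotientMap (mk : Path p p → TopFundamentalGroup X p) :=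
  ZerothHomotopy.isQuotientMap_mk

theorem mk_eq_mk {f g : Path p p} : mk f = mk g ↔ f.Homotopic g :=
  Quotient.eq.trans joined_iff_homotopic

theorem exists_isEmbedding_of_joined {q : X} (h : Joined p q) :
    ∃ i : TopFundamentalGroup X q → TopFundamentalGroup X p, IsEmbedding i := by
  obtain ⟨δ⟩ := h
  have hconj {x y : X} (γ : Path x y) : Continuous fun f : Path y y => γ.trans (f.trans γ.symm) :=
    continuous_const.path_trans (continuous_id.path_trans continuous_const)
  refine ⟨_, isEmbedding_zerothHomotopyMap ⟨_, hconj δ⟩ ⟨_, hconj δ.symm⟩ fun f => ?_⟩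
  rw [joined_iff_homotopic, ← Path.Homotopic.Quotient.eq]
  simp [Path.Homotopic.Quotient.mk_trans, Path.Homotopic.Quotient.trans_assoc,
    ← Path.Homotopic.Quotient.trans_assoc (.symm (.mk δ)) (.mk δ)]

theorem exists_isEmbedding_of_leftInverse {e : X → Y} {r : Y → X} (he : Continuous e)
    (hr : Continuous r) (h : Function.LeftInverse r e) :
    ∃ i : TopFundamentalGroup X p → TopFundamentalGroup Y (e p), IsEmbedding i := by
  have he_map : Continuous fun f : Path p p => f.map he :=
    Path.continuous_uncurry_iff.1 (he.comp (continuous_fst.eval continuous_snd))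
  have hr_map : Continuous fun f : Path (e p) (e p) => (f.map hr).cast (h p).symm (h p).symm :=
    Path.continuous_uncurry_iff.1 (hr.comp (continuous_fst.eval continuous_snd))
  refine ⟨_, isEmbedding_zerothHomotopyMap ⟨_, he_map⟩ ⟨_, hr_map⟩ fun f => ?_⟩
  convert! Joined.refl f using 1
  exact Path.ext (funext fun t => h (f t))

open Filter in
theorem not_firstCountableTopology {X : Type*} [MetricSpace X] {p : X} {Y : ℕ → Set X}
    (h : IsHawaiianDecomposition p Y) [T1Space (TopFundamentalGroup X p)] :
    ¬ FirstCountableTopology (TopFundamentalGroup X p) := by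
  intro hcount
  choose f hf using h.exists_not_homotopic_refl
  let s (n : ℕ) (b : Bool) : ℕ := bif b then n + 1 else 0
  have hs (n : ℕ) : (s n).Injective := Bool.injective_iff.2 n.succ_ne_zero.symm
  let c (k n : ℕ) : Path p p := commutatorPow (h.pieceLoop (f 0)) (h.pieceLoop (f (n + 1))) k
  have hc (k : ℕ) : Tendsto (fun n => mk (c k n)) atTop (𝓝 (mk (Path.refl p))) := by
    rw [← mk_eq_mk.2 (commutatorPow_refl_homotopic (h.pieceLoop (f 0)) k)]
    exact ((isQuotientMap_mk.continuous.comp (continuous_commutatorPow _ k)).tendsto _).comp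
      ((h.tendsto_pieceLoop f).comp (tendsto_add_atTop_nat 1))
  have hlength (k n : ℕ) {g : Path p p} (hg : mk g = mk (c k n)) :
      wordLength ((h.collapsePair (hs n)).spell (FundamentalGroup.fromPath (.mk g))) = 4 * k := by
    rw [Path.Homotopic.Quotient.eq.2 (mk_eq_mk.1 hg)]
    exact h.wordLength_spell_commutatorPow (hs n) (fun b => f (s n b)) (fun b => hf _) k
  obtain ⟨φ, hφ⟩ := exists_tendsto_diagonal fun k => hc (k + 1)
  have hfinite : LocallyFinite fun k => mk ⁻¹' {mk (c (k + 1) (φ k))} := fun g => by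
    obtain ⟨M, hM⟩ := h.exists_eventually_wordLength_spell_le 0 g
    refine ⟨_, hM, (Set.finite_lt_nat M).subset ?_⟩
    rintro k ⟨g', hg', hle⟩
    have hlt := (hlength (k + 1) (φ k) hg').symm.trans_le (hle (hs _) rfl)
    change k < M
    omega
  have hclosed := isClosed_range_of_locallyFinite_preimage isQuotientMap_mk hfinite
  obtain ⟨k, hk⟩ := hclosed.mem_of_tendsto hφ (.of_forall fun k => ⟨k, rfl⟩)
  have hrefl := hlength (k + 1) (φ k) hk.symm
  have hone : FundamentalGroup.fromPath (.mk (Path.refl p)) = 1 := rfl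
  rw [hone, map_one, wordLength_one] at hrefl
  omega

end TopFundamentalGroup

theorem theorem3_general {X : Type*} [MetricSpace X] (p : X) (hX : IsSimilarToHawaiianEarring X p)
    {Y : Type*} [TopologicalSpace Y] (y₀ : Y) [T1Space (TopFundamentalGroup Y y₀)]
    [FirstCountableTopology (TopFundamentalGroup Y y₀)] :
    ¬ ∃ e : X → Y, IsEmbedding e ∧ Joined y₀ (e p) ∧ IsRetract (Set.range e) := by
  rintro ⟨e, he, hjoined, r, hr⟩
  obtain ⟨Z, hZ⟩ := hX
  have hleft : Function.LeftInverse (he.toHomeomorph.symm ∘ r) e := fun x =>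
    (he.toHomeomorph.symm_apply_eq).2 (hr ⟨e x, x, rfl⟩)
  obtain ⟨i, hi⟩ := TopFundamentalGroup.exists_isEmbedding_of_joined hjoined
  obtain ⟨j, hj⟩ := TopFundamentalGroup.exists_isEmbedding_of_leftInverse (p := p) he.continuous
    (he.toHomeomorph.symm.continuous.comp r.continuous) hleft
  have hij : IsEmbedding (i ∘ j) := hi.comp hj
  have := hij.t1Space
  exact TopFundamentalGroup.not_firstCountableTopology hZ hij.isInducing.firstCountableTopology

theorem theorem3 {X : Type*} [MetricSpace X] (p : X) (hX : IsSimilarToHawaiianEarring X p)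
    {Y : Type*} [TopologicalSpace Y] [TopologicalSpace.MetrizableSpace Y] (y₀ : Y)
    (hY : TopologicalSpace.IsCompletelyMetrizableSpace (TopFundamentalGroup Y y₀)) :
    ¬ ∃ e : X → Y, IsEmbedding e ∧ Joined y₀ (e p) ∧ IsRetract (Set.range e) :=
  theorem3_general p hX y₀
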